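/- Let $k$ be a field and let $A$ and $B$ be commutative Noetherian $k$-algebras such that $R = A \otimes_k B$ is also Noetherian. For an ideal $I$ of a Noetherian commutative ring $S$ and an integer $s \ge 0$, define the two notions of $s$-th symbolic power $${}^{\mathtt m}I^{(s)} = \bigcap_{\mathfrak p \in \operatorname{Min}_S(I)} (I^s S_{\mathfrak p} \cap S), \qquad {}^{\mathtt a}I^{(s)} = \bigcap_{\mathfrak p \in \operatorname{Ass}_S(I)} (I^s S_{\mathfrak p} \cap S),$$ where $\operatorname{Min}_S(I)$ is the set of minimal primes of $I$, $\operatorname{Ass}_S(I)$ is the set of associated primes of the $S$-module $S/I$, and $I^sS_{\mathfrak p}\cap S$ denotes the preimage of $I^sS_{\mathfrak p}$ under $S \to S_{\mathfrak p}$; in particular ${}^{\mathtt m}I^{(0)} = {}^{\mathtt a}I^{(0)} = S$. Let $I \subseteq A$ and $J \subseteq B$ be nonzero proper ideals, and let $I + J$ denote the ideal $IR + JR$ of $R$. Then, for every integer $s \ge 0$, $${}^{\mathtt m}(I+J)^{(s)} = \sum_{i=0}^s {}^{\mathtt m}I^{(i)}\; {}^{\mathtt m}J^{(s-i)} \qquad\text{and}\qquad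 {}^{\mathtt a}(I+J)^{(s)} = \sum_{i=0}^s {}^{\mathtt a}I^{(i)}\; {}^{\mathtt a}J^{(s-i)},$$ where on the right-hand sides the ideals of $A$ and of $B$ are identified with their extensions to $R$. -/

import Mathlib

open scoped TensorProduct

/-- The contraction `I A_p ∩ A` to `A` of the extension of `I` to the localization at `p`. -/
def Ideal.localContraction {A : Type*} [CommRing A] (I : Ideal A) (p : PrimeSpectrum A) :
    Ideal A :=
  (I.map (algebraMap A (Localization.AtPrime p.asIdeal))).comap
    (algebraMap A (Localization.AtPrime p.asIdeal))

/-- The `s`-th symbolic power of `I` defined by minimal primes: the intersection of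
`I ^ s A_p ∩ A` over the minimal primes `p` of `I`. -/
def Ideal.minSymbolicPower {A : Type*} [CommRing A] (I : Ideal A) (s : ℕ) : Ideal A :=
  ⨅ (p : PrimeSpectrum A) (_ : p.asIdeal ∈ I.minimalPrimes), (I ^ s).localContraction p

/-- The `s`-th symbolic power of `I` defined by associated primes: the intersection of
`I ^ s A_p ∩ A` over the associated primes `p` of the `A`-module `A ⧸ I`. (Over a Noetherian
ring, `associatedPrimes` consists of the primes that are annihilators of elements, see
`Submodule.isAssociatedPrime_iff`.) -/
def Ideal.assSymbolicPower {A : Type*} [CommRing A] (I : Ideal A) (s : ℕ) : Ideal A :=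
  ⨅ (p : PrimeSpectrum A) (_ : p.asIdeal ∈ associatedPrimes A (A ⧸ I)),
    (I ^ s).localContraction p

/-- The extension to `A ⊗[k] B` of an ideal of `A`. -/
def Ideal.extendLeft (k : Type*) {A : Type*} (B : Type*) [Field k] [CommRing A] [CommRing B]
    [Algebra k A] [Algebra k B] (I : Ideal A) : Ideal (A ⊗[k] B) :=
  I.map (Algebra.TensorProduct.includeLeft : A →ₐ[k] A ⊗[k] B)

/-- The extension to `A ⊗[k] B` of an ideal of `B`. -/
def Ideal.extendRight (k : Type*) (A : Type*) {B : Type*} [Field k] [CommRing A] [CommRing B]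
    [Algebra k A] [Algebra k B] (J : Ideal B) : Ideal (A ⊗[k] B) :=
  J.map (Algebra.TensorProduct.includeRight : B →ₐ[k] A ⊗[k] B)

/-! Both notions are symbolic powers with respect to a set of primes, X for I, Y for J and Z for I +
J. The inclusion of the sum needs only that each P in Z contracts into some p in X and some q in Y:
multipliers outside p and q give a product outside P.

For the converse, prime avoidance turns membership of x into one relation t * x ∈ (I + J)^s with t
outside all of Z. As (I + J)^s ⊆ I^(i+1) + J^(s-i), x is multiplied by t into each such sum. If t is
regular on κ(p) ⊗ κ(q) for all p in X and q in Y, dévissage makes it regular on tensor products of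
the quotients A_p/(I^(i+1) A_p + m^n) and their analogues for B. By Krull's intersection theorem
these detect A modulo the symbolic power, and joint injectivity survives tensoring over a field. So
x lies in the sum of the (i+1)-st symbolic power of I and the (s-i)-th of J for every i < s. Over a
field, extended ideals satisfy V ∩ W = VW, which makes the intersection of these sums the binomial
sum (`mem_sum_mul_of_forall_mem_sup`).

It remains to show that t is regular on κ(p) ⊗ κ(q). For associated primes, A/p ⊗ B/q embeds in A/I
⊗ B/J. For minimal primes, a tensor product of fields is unmixed: it is integral and torsion-free
over a domain, so its zero divisors lie in minimal primes, and these contract to minimal primes of I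
+ J. -/

namespace TensorProduct

/-! ### Joint injectivity over a field -/

section Joint

variable {k V W : Type*} [Field k] [AddCommGroup V] [Module k V] [AddCommGroup W] [Module k W]

/-- A jointly injective family of linear maps stays so after tensoring on the right. -/
theorem eq_zero_of_forall_rTensor_eq_zero {ι : Type*} {V' : ι → Type*}
    [∀ i, AddCommGroup (V' i)] [∀ i, Module k (V' i)] (f : ∀ i, V →ₗ[k] V' i)
    (hf : ∀ v, (∀ i, f i v = 0) → v = 0) (z : V ⊗[k] W)
    (hz : ∀ i, (f i).rTensor W z = 0) : z = 0 := by
  classical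
  -- A basis of W turns z into a finite family of vectors of V, on which each `f i` acts
  -- coordinatewise.
  let b := Module.Basis.ofVectorSpace k W
  have key : ∀ i (y : V ⊗[k] W) j, equivFinsuppOfBasisRight b ((f i).rTensor W y) j =
      f i (equivFinsuppOfBasisRight b y j) := by
    intro i y j
    induction y with
    | zero => simp
    | tmul v w => simp
    | add x y hx hy => simp [hx, hy]
  rw [← (equivFinsuppOfBasisRight (M := V) b).map_eq_zero_iff]
  ext j
  refine hf _ fun i => ?_
  rw [← key, hz, map_zero, Finsupp.coe_zero, Pi.zero_apply]

/-- A jointly injective family of linear maps stays so after tensoring on the left. -/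
theorem eq_zero_of_forall_lTensor_eq_zero {ι : Type*} {W' : ι → Type*}
    [∀ i, AddCommGroup (W' i)] [∀ i, Module k (W' i)] (g : ∀ i, W →ₗ[k] W' i)
    (hg : ∀ w, (∀ i, g i w = 0) → w = 0) (z : V ⊗[k] W)
    (hz : ∀ i, (g i).lTensor V z = 0) : z = 0 := by
  rw [← (TensorProduct.comm k V W).map_eq_zero_iff]
  refine eq_zero_of_forall_rTensor_eq_zero g hg _ fun i => ?_
  rw [← LinearMap.comm_comp_lTensor_comp_comm_eq]
  simp [hz]

/-- Tensor products of two jointly injective families of linear maps are jointly injective. -/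
theorem eq_zero_of_forall_map_eq_zero {ι κ : Type*} {V' : ι → Type*} {W' : κ → Type*}
    [∀ i, AddCommGroup (V' i)] [∀ i, Module k (V' i)]
    [∀ j, AddCommGroup (W' j)] [∀ j, Module k (W' j)]
    (f : ∀ i, V →ₗ[k] V' i) (hf : ∀ v, (∀ i, f i v = 0) → v = 0)
    (g : ∀ j, W →ₗ[k] W' j) (hg : ∀ w, (∀ j, g j w = 0) → w = 0)
    (z : V ⊗[k] W) (hz : ∀ i j, map (f i) (g j) z = 0) : z = 0 := by
  refine eq_zero_of_forall_rTensor_eq_zero f hf z fun i => ?_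
  refine eq_zero_of_forall_lTensor_eq_zero g hg _ fun j => ?_
  rw [← LinearMap.comp_apply, LinearMap.lTensor_comp_rTensor, hz]

end Joint

/-! ### Regularity of a tensor on a tensor product of modules -/

section Act

variable (k A B M N : Type*) [Field k] [CommRing A] [CommRing B] [Algebra k A] [Algebra k B]
  [AddCommGroup M] [Module k M] [Module A M] [IsScalarTower k A M]
  [AddCommGroup N] [Module k N] [Module B N] [IsScalarTower k B N]

/-- The action of `A ⊗[k] B` on the tensor product of an `A`-module and a `B`-module. -/
noncomputable def actHom : A ⊗[k] B →ₐ[k] Module.End k (M ⊗[k] N) :=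
  (Module.endTensorEndAlgHom (R := k) (S := k) (A := k) (M := M) (N := N)).comp
    (Algebra.TensorProduct.map (Algebra.lsmul k k M) (Algebra.lsmul k k N))

variable {k A B M N}

@[simp]
theorem actHom_tmul_tmul (a : A) (b : B) (m : M) (n : N) :
    actHom k A B M N (a ⊗ₜ b) (m ⊗ₜ n) = (a • m) ⊗ₜ (b • n) := by
  simp [actHom, Module.endTensorEndAlgHom_apply]

theorem map_actHom {M' N' : Type*}
    [AddCommGroup M'] [Module k M'] [Module A M'] [IsScalarTower k A M']
    [AddCommGroup N'] [Module k N'] [Module B N'] [IsScalarTower k B N']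
    (f : M →ₗ[A] M') (g : N →ₗ[B] N') (t : A ⊗[k] B) (z : M ⊗[k] N) :
    map (f.restrictScalars k) (g.restrictScalars k) (actHom k A B M N t z) =
      actHom k A B M' N' t (map (f.restrictScalars k) (g.restrictScalars k) z) := by
  induction t with
  | zero => simp
  | add t u ht hu => simp [ht, hu]
  | tmul a b =>
    induction z with
    | zero => simp
    | add x y hx hy => simp only [map_add, hx, hy]
    | tmul m n => simp

theorem comm_actHom (t : A ⊗[k] B) (z : M ⊗[k] N) :
    TensorProduct.comm k M N (actHom k A B M N t z) =
      actHom k B A N M (TensorProduct.comm k A B t) (TensorProduct.comm k M N z) := by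
  induction t with
  | zero => simp
  | add t u ht hu => simp [ht, hu]
  | tmul a b =>
    induction z with
    | zero => simp
    | add x y hx hy => simp only [map_add, hx, hy]
    | tmul m n => simp

theorem actHom_injective_comm (t : A ⊗[k] B) :
    Function.Injective (actHom k B A N M (TensorProduct.comm k A B t)) ↔
      Function.Injective (actHom k A B M N t) := by
  have h : TensorProduct.comm k M N ∘ actHom k A B M N t =
      actHom k B A N M (TensorProduct.comm k A B t) ∘ TensorProduct.comm k M N :=
    funext fun z => comm_actHom t z
  rw [← (TensorProduct.comm k M N).injective.of_comp_iff (actHom k A B M N t), h,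
    Function.Injective.of_comp_iff' _ (TensorProduct.comm k M N).bijective]

theorem actHom_tmul_one_injective {a : A} (ha : IsSMulRegular M a) :
    Function.Injective (actHom k A B M N (a ⊗ₜ 1)) := by
  have h : actHom k A B M N (a ⊗ₜ 1) = (Algebra.lsmul k k M a).rTensor N :=
    TensorProduct.ext' fun m n => by simp
  rw [h]
  exact Module.Flat.rTensor_preserves_injective_linearMap _ ha

theorem actHom_one_tmul_injective {b : B} (hb : IsSMulRegular N b) :
    Function.Injective (actHom k A B M N (1 ⊗ₜ b)) := by
  have h : actHom k A B M N (1 ⊗ₜ b) = (Algebra.lsmul k k N b).lTensor M :=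
    TensorProduct.ext' fun m n => by simp
  rw [h]
  exact Module.Flat.lTensor_preserves_injective_linearMap _ hb

theorem actHom_eq_mul {A' B' : Type*} [CommRing A'] [CommRing B'] [Algebra k A'] [Algebra k B']
    [Algebra A A'] [IsScalarTower k A A'] [Algebra B B'] [IsScalarTower k B B']
    (t : A ⊗[k] B) (z : A' ⊗[k] B') :
    actHom k A B A' B' t z =
      Algebra.TensorProduct.map (IsScalarTower.toAlgHom k A A') (IsScalarTower.toAlgHom k B B') t
        * z := by
  induction t with
  | zero => simp
  | add t u ht hu => simp [ht, hu, add_mul]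
  | tmul a b =>
    induction z with
    | zero => simp
    | add x y hx hy => simp only [map_add, hx, hy, mul_add]
    | tmul m n => simp [_root_.Algebra.smul_def]

theorem actHom_injective_iff_mem_nonZeroDivisors {A' B' : Type*} [CommRing A'] [CommRing B']
    [Algebra k A'] [Algebra k B']
    [Algebra A A'] [IsScalarTower k A A'] [Algebra B B'] [IsScalarTower k B B'] (t : A ⊗[k] B) :
    Function.Injective (actHom k A B A' B' t) ↔
      Algebra.TensorProduct.map (IsScalarTower.toAlgHom k A A') (IsScalarTower.toAlgHom k B B') t
        ∈ nonZeroDivisors (A' ⊗[k] B') := by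
  rw [injective_iff_map_eq_zero, mem_nonZeroDivisors_iff_left]
  simp only [actHom_eq_mul]

theorem actHom_injective_of_forall {ι κ : Type*} {M' : ι → Type*} {N' : κ → Type*}
    [∀ i, AddCommGroup (M' i)] [∀ i, Module k (M' i)] [∀ i, Module A (M' i)]
    [∀ i, IsScalarTower k A (M' i)]
    [∀ j, AddCommGroup (N' j)] [∀ j, Module k (N' j)] [∀ j, Module B (N' j)]
    [∀ j, IsScalarTower k B (N' j)]
    (f : ∀ i, M →ₗ[A] M' i) (hf : ∀ v, (∀ i, f i v = 0) → v = 0)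
    (g : ∀ j, N →ₗ[B] N' j) (hg : ∀ w, (∀ j, g j w = 0) → w = 0)
    (t : A ⊗[k] B) (ht : ∀ i j, Function.Injective (actHom k A B (M' i) (N' j) t)) :
    Function.Injective (actHom k A B M N t) := by
  rw [injective_iff_map_eq_zero]
  intro z hz
  refine eq_zero_of_forall_map_eq_zero (fun i => (f i).restrictScalars k) hf
    (fun j => (g j).restrictScalars k) hg z fun i j => ?_
  apply ht i j
  rw [← map_actHom, hz, map_zero, map_zero]

theorem actHom_injective_of_linearMap_injective {M' N' : Type*}
    [AddCommGroup M'] [Module k M'] [Module A M'] [IsScalarTower k A M']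
    [AddCommGroup N'] [Module k N'] [Module B N'] [IsScalarTower k B N']
    (f : M →ₗ[A] M') (hf : Function.Injective f) (g : N →ₗ[B] N') (hg : Function.Injective g)
    (t : A ⊗[k] B) (ht : Function.Injective (actHom k A B M' N' t)) :
    Function.Injective (actHom k A B M N t) :=
  actHom_injective_of_forall (ι := Unit) (κ := Unit) (fun _ => f)
    (fun _ hv => (map_eq_zero_iff f hf).1 (hv ())) (fun _ => g)
    (fun _ hv => (map_eq_zero_iff g hg).1 (hv ())) t fun _ _ => ht

/-- Injectivity of the action of a tensor passes to extensions in the left factor. -/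
theorem actHom_injective_of_submodule_of_quotient (M' : Submodule A M) (t : A ⊗[k] B)
    (h₁ : Function.Injective (actHom k A B M' N t))
    (h₂ : Function.Injective (actHom k A B (M ⧸ M') N t)) :
    Function.Injective (actHom k A B M N t) := by
  rw [injective_iff_map_eq_zero]
  intro z hz
  have hex : Function.Exact (map (M'.subtype.restrictScalars k)
      ((LinearMap.id : N →ₗ[B] N).restrictScalars k))
      (map (M'.mkQ.restrictScalars k) ((LinearMap.id : N →ₗ[B] N).restrictScalars k)) :=
    rTensor_exact N (f := M'.subtype.restrictScalars k) (g := M'.mkQ.restrictScalars k)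
      (LinearMap.exact_subtype_mkQ M') M'.mkQ_surjective
  have hinj : Function.Injective (map (M'.subtype.restrictScalars k)
      ((LinearMap.id : N →ₗ[B] N).restrictScalars k)) :=
    Module.Flat.rTensor_preserves_injective_linearMap (M := N) (M'.subtype.restrictScalars k)
      M'.injective_subtype
  have hz' : map (M'.mkQ.restrictScalars k) ((LinearMap.id : N →ₗ[B] N).restrictScalars k) z = 0 :=
    h₂ (by rw [← map_actHom, hz, map_zero, map_zero])
  obtain ⟨y, rfl⟩ := (hex z).1 hz'
  rw [← map_actHom, map_eq_zero_iff _ hinj] at hz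
  rw [(map_eq_zero_iff _ h₁).1 hz, map_zero]

end Act

/-! ### Dévissage to residue fields -/

section Devissage

variable {k A B : Type*} [Field k] [CommRing A] [CommRing B] [Algebra k A] [Algebra k B]

/-- Induction on the exponent along m M ⊆ M: the submodule is killed by one power less, and M / m M
is a vector space over A / m, whose coordinates map it jointly injectively to A / m. No finiteness
of M is needed. -/
theorem actHom_injective_of_quotient_maximal_left {N : Type*}
    [AddCommGroup N] [Module k N] [Module B N] [IsScalarTower k B N]
    (m : Ideal A) [m.IsMaximal] (t : A ⊗[k] B)
    (ht : Function.Injective (actHom k A B (A ⧸ m) N t)) (n : ℕ) :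
    ∀ (M : Type*) [AddCommGroup M] [Module k M] [Module A M] [IsScalarTower k A M],
      (∀ x ∈ m ^ n, ∀ v : M, x • v = 0) → Function.Injective (actHom k A B M N t) := by
  induction n with
  | zero =>
    intro M _ _ _ _ hM
    have : Subsingleton M :=
      ⟨fun x y => by rw [← one_smul A x, ← one_smul A y, hM 1 (by simp), hM 1 (by simp)]⟩
    exact Function.injective_of_subsingleton _
  | succ n ih =>
    intro M _ _ _ _ hM
    refine actHom_injective_of_submodule_of_quotient (m • (⊤ : Submodule A M)) t
      (ih _ fun x hx v => ?_) ?_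
    · obtain ⟨v, hv⟩ := v
      ext
      change x • v = 0
      refine Submodule.smul_induction_on hv (fun r hr w _ => ?_) fun v w hv hw => ?_
      · rw [← mul_smul]
        exact hM _ (by rw [pow_succ]; exact Ideal.mul_mem_mul hx hr) w
      · rw [smul_add, hv, hw, add_zero]
    · let := Ideal.Quotient.field m
      let b := Module.Basis.ofVectorSpace (A ⧸ m) (M ⧸ (m • (⊤ : Submodule A M)))
      refine actHom_injective_of_forall (κ := Unit)
        (fun i => (b.coord i).restrictScalars A) (fun v hv => ?_)
        (fun _ => LinearMap.id) (fun w hw => hw ()) t fun _ _ => ht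
      exact b.forall_coord_eq_zero_iff.1 hv

/-- If a tensor acts injectively on the tensor product of two residue fields, then it does so on
the tensor product of modules killed by powers of the corresponding maximal ideals. -/
theorem actHom_injective_of_quotient_maximal (m : Ideal A) [m.IsMaximal] (n : Ideal B)
    [n.IsMaximal] (t : A ⊗[k] B)
    (ht : Function.Injective (actHom k A B (A ⧸ m) (B ⧸ n) t)) {M N : Type*}
    [AddCommGroup M] [Module k M] [Module A M] [IsScalarTower k A M]
    [AddCommGroup N] [Module k N] [Module B N] [IsScalarTower k B N] (a b : ℕ)
    (hM : ∀ x ∈ m ^ a, ∀ v : M, x • v = 0) (hN : ∀ x ∈ n ^ b, ∀ v : N, x • v = 0) :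
    Function.Injective (actHom k A B M N t) := by
  refine actHom_injective_of_quotient_maximal_left m t ?_ a M hM
  rw [← actHom_injective_comm] at ht ⊢
  exact actHom_injective_of_quotient_maximal_left n _ ht b N hN

end Devissage

end TensorProduct

theorem Algebra.TensorProduct.map_map_apply {k A A' A'' B B' B'' : Type*} [CommRing k]
    [CommRing A] [CommRing A'] [CommRing A''] [CommRing B] [CommRing B'] [CommRing B'']
    [Algebra k A] [Algebra k A'] [Algebra k A''] [Algebra k B] [Algebra k B'] [Algebra k B'']
    (f : A →ₐ[k] A') (f' : A' →ₐ[k] A'') (g : B →ₐ[k] B') (g' : B' →ₐ[k] B'') (z : A ⊗[k] B) :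
    map f' g' (map f g z) = map (f'.comp f) (g'.comp g) z := by
  rw [map_comp, AlgHom.comp_apply]

/-! ### Extended ideals and binomial sums -/

namespace Ideal

/-- In a term I^a J^(n+m-a), either a > n or n + m - a ≥ m. -/
theorem add_pow_add_le {R : Type*} [CommRing R] (I J : Ideal R) (n m : ℕ) :
    (I + J) ^ (n + m) ≤ I ^ (n + 1) ⊔ J ^ m := by
  rw [add_pow, sum_eq_sup]
  refine Finset.sup_le fun a _ => (mul_le_inf.trans inf_le_left).trans ?_
  rcases Nat.lt_or_ge n a with h | h
  · have h1 : I ^ a ≤ I ^ (n + 1) := pow_le_pow_right h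
    exact (mul_le_inf.trans inf_le_left).trans (h1.trans le_sup_left)
  · have h1 : J ^ (n + m - a) ≤ J ^ m := pow_le_pow_right (by omega)
    exact (mul_le_inf.trans inf_le_right).trans (h1.trans le_sup_right)

section Extend

variable {k A B : Type*} [Field k] [CommRing A] [CommRing B] [Algebra k A] [Algebra k B]

theorem extendLeft_mono {I I' : Ideal A} (h : I ≤ I') :
    I.extendLeft k B ≤ I'.extendLeft k B := map_mono h

theorem extendRight_mono {J J' : Ideal B} (h : J ≤ J') :
    J.extendRight k A ≤ J'.extendRight k A := map_mono h

theorem extendLeft_pow (I : Ideal A) (n : ℕ) :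
    (I ^ n).extendLeft k B = I.extendLeft k B ^ n := Ideal.map_pow _ _ _

theorem extendRight_pow (J : Ideal B) (n : ℕ) :
    (J ^ n).extendRight k A = J.extendRight k A ^ n := Ideal.map_pow _ _ _

/-- By flatness I ⊗ B/J embeds in A ⊗ B/J. An element of I ⊗ B that dies in A ⊗ B/J therefore
already dies in I ⊗ B/J, so it comes from I ⊗ J. -/
theorem extendLeft_inf_extendRight (I : Ideal A) (J : Ideal B) :
    I.extendLeft k B ⊓ J.extendRight k A = I.extendLeft k B * J.extendRight k A := by
  refine le_antisymm (fun z hz => ?_) mul_le_inf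
  obtain ⟨hzI, hzJ⟩ := hz
  have hzI' : z ∈ (I.extendLeft k B).restrictScalars k := hzI
  have hzJ' : z ∈ (J.extendRight k A).restrictScalars k := hzJ
  rw [extendLeft, map_includeLeft_eq] at hzI'
  rw [extendRight, map_includeRight_eq] at hzJ'
  obtain ⟨y, rfl⟩ := hzI'
  have hexA := lTensor_exact A (LinearMap.exact_subtype_mkQ (J.restrictScalars k))
    (Submodule.mkQ_surjective _)
  have hexI := lTensor_exact (I.restrictScalars k) (LinearMap.exact_subtype_mkQ (J.restrictScalars k))
    (Submodule.mkQ_surjective _)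
  have h0 := (hexA _).2 hzJ'
  rw [← LinearMap.comp_apply, LinearMap.lTensor_comp_rTensor,
    ← LinearMap.rTensor_comp_lTensor, LinearMap.comp_apply,
    map_eq_zero_iff _ (Module.Flat.rTensor_preserves_injective_linearMap _
      (Submodule.injective_subtype _))] at h0
  obtain ⟨x, rfl⟩ := (hexI _).1 h0
  clear h0 hzI hzJ hzJ' hexA hexI
  induction x with
  | zero => simp
  | add x y hx hy => simpa only [map_add] using add_mem hx hy
  | tmul a b =>
    have : (a : A) ⊗ₜ[k] (b : B) = ((a : A) ⊗ₜ[k] (1 : B)) * ((1 : A) ⊗ₜ[k] (b : B)) := by simp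
    simp only [LinearMap.lTensor_tmul, LinearMap.rTensor_tmul, Submodule.subtype_apply, this]
    exact mul_mem_mul (mem_map_of_mem Algebra.TensorProduct.includeLeft a.2)
      (mem_map_of_mem Algebra.TensorProduct.includeRight b.2)

theorem extendLeft_sup_extendRight (I : Ideal A) (J : Ideal B) :
    I.extendLeft k B ⊔ J.extendRight k A =
      RingHom.ker (Algebra.TensorProduct.map (Quotient.mkₐ k I) (Quotient.mkₐ k J)) := by
  rw [Algebra.TensorProduct.map_ker _ _ (Quotient.mkₐ_surjective k I)
    (Quotient.mkₐ_surjective k J)]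
  congr 2 <;> exact (mk_ker (I := _)).symm

end Extend

/-- The binomial sum of two descending filtrations in general position contains the
intersection of the pairwise sums. -/
theorem mem_sum_mul_of_forall_mem_sup {R : Type*} [CommRing R] {V W : ℕ → Ideal R}
    (hW : Antitone W) (hV : Antitone V) (hV0 : V 0 = ⊤) (hW0 : W 0 = ⊤)
    (h : ∀ i j, V i ⊓ W j ≤ V i * W j) {s : ℕ} {z : R}
    (hz : ∀ i, i < s → z ∈ V (i + 1) ⊔ W (s - i)) :
    z ∈ ∑ i ∈ Finset.range (s + 1), V i * W (s - i) := by
  have key : ∀ n ≤ s, z ∈ V n ⊔ ∑ i ∈ Finset.range n, V i * W (s - i) := by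
    intro n
    induction n with
    | zero => simp [hV0]
    | succ n ih =>
      intro hn
      obtain ⟨v, hv, σ, hσ, hvσ⟩ := Submodule.mem_sup.1 (ih (by omega))
      obtain ⟨v', hv', w, hw, hvw⟩ := Submodule.mem_sup.1 (hz n (by omega))
      have hσW : σ ∈ W (s - n) := by
        refine (?_ : ∑ i ∈ Finset.range n, V i * W (s - i) ≤ W (s - n)) hσ
        rw [sum_eq_sup]
        refine Finset.sup_le fun i hi => (mul_le_inf.trans inf_le_right).trans (hW ?_)
        have := Finset.mem_range.1 hi
        omega
      -- From z = v + σ = v' + w, the difference w - σ = v - v' lies in both filtrations; it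
      -- supplies the n-th summand.
      have hmem : w - σ ∈ V n * W (s - n) := by
        refine h _ _ ⟨?_, sub_mem hw hσW⟩
        have : w - σ = v - v' := by linear_combination hvw - hvσ
        rw [this]
        exact sub_mem hv (hV (Nat.le_succ n) hv')
      refine Submodule.mem_sup.2 ⟨v', hv', σ + (w - σ), ?_, by linear_combination hvw⟩
      rw [Finset.sum_range_succ]
      exact Submodule.add_mem_sup hσ hmem
  -- At n = s the leftover `V s` is the last summand, because `W 0 = ⊤`.
  have := key s le_rfl
  rwa [Finset.sum_range_succ, Nat.sub_self, hW0, mul_top, Submodule.add_eq_sup, sup_comm]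

/-! ### Local contractions and Krull's intersection theorem -/

section LocalContraction

variable {A : Type*} [CommRing A]

theorem mem_localContraction {I : Ideal A} {p : PrimeSpectrum A} {x : A} :
    x ∈ I.localContraction p ↔ ∃ u ∉ p.asIdeal, u * x ∈ I := by
  rw [localContraction, mem_comap, IsLocalization.algebraMap_mem_map_algebraMap_iff
    p.asIdeal.primeCompl]
  rfl

theorem localContraction_mono {I J : Ideal A} (h : I ≤ J) (p : PrimeSpectrum A) :
    I.localContraction p ≤ J.localContraction p := comap_mono (map_mono h)

theorem mem_of_forall_mem_sup_pow_maximalIdeal [IsNoetherianRing A] [IsLocalRing A]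
    {I : Ideal A} {x : A} (hx : ∀ n : ℕ, x ∈ I ⊔ IsLocalRing.maximalIdeal A ^ n) : x ∈ I := by
  have h := Ideal.iInf_pow_smul_eq_bot_of_isLocalRing (M := A ⧸ I) (IsLocalRing.maximalIdeal A)
    (IsLocalRing.maximalIdeal.isMaximal A).ne_top
  rw [← Quotient.eq_zero_iff_mem, ← Submodule.mem_bot A, ← h, Submodule.mem_iInf]
  intro n
  obtain ⟨v, hv, u, hu, rfl⟩ := Submodule.mem_sup.1 (hx n)
  have : Quotient.mk I (v + u) = u • (1 : A ⧸ I) := by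
    rw [map_add, Quotient.eq_zero_iff_mem.2 hv, zero_add, Algebra.smul_def, mul_one]
    rfl
  rw [this]
  exact Submodule.smul_mem_smul hu trivial

/-- The quotients of `A_p` by `I A_p` plus the powers of the maximal ideal. -/
abbrev localThickening (I : Ideal A) (p : PrimeSpectrum A) (n : ℕ) :
    Ideal (Localization.AtPrime p.asIdeal) :=
  I.map (algebraMap A (Localization.AtPrime p.asIdeal)) ⊔
    IsLocalRing.maximalIdeal (Localization.AtPrime p.asIdeal) ^ n

theorem localContraction_le_comap_localThickening (I : Ideal A) (p : PrimeSpectrum A) (n : ℕ) :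
    I.localContraction p ≤
      (I.localThickening p n).comap (algebraMap A (Localization.AtPrime p.asIdeal)) :=
  comap_mono le_sup_left

theorem mem_localContraction_of_forall [IsNoetherianRing A] {I : Ideal A} {p : PrimeSpectrum A}
    {x : A} (hx : ∀ n, algebraMap A (Localization.AtPrime p.asIdeal) x ∈
      I.localThickening p n) : x ∈ I.localContraction p :=
  have := IsLocalization.isNoetherianRing p.asIdeal.primeCompl
    (Localization.AtPrime p.asIdeal) ‹_›
  mem_of_forall_mem_sup_pow_maximalIdeal (A := Localization.AtPrime p.asIdeal) hx

end LocalContraction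

/-! ### From residue fields to thickenings -/

section Tensor

variable {k A B : Type*} [Field k] [CommRing A] [CommRing B] [Algebra k A] [Algebra k B]

/-- The map from `A ⊗[k] B` to the tensor product of the residue fields at two primes. -/
noncomputable def residueTensor (k : Type*) {A B : Type*} [Field k] [CommRing A] [CommRing B]
    [Algebra k A] [Algebra k B] (p : PrimeSpectrum A) (q : PrimeSpectrum B) :
    A ⊗[k] B →ₐ[k] p.asIdeal.ResidueField ⊗[k] q.asIdeal.ResidueField :=
  Algebra.TensorProduct.map (IsScalarTower.toAlgHom k A _) (IsScalarTower.toAlgHom k B _)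

/-- The map from `A` to the quotient of `A_p` by `I A_p` plus a power of the maximal ideal. -/
noncomputable def toLocalThickening (k : Type*) {A : Type*} [Field k] [CommRing A]
    [Algebra k A] (I : Ideal A) (p : PrimeSpectrum A) (n : ℕ) :
    A →ₐ[k] Localization.AtPrime p.asIdeal ⧸ I.localThickening p n :=
  (Quotient.mkₐ k _).comp (IsScalarTower.toAlgHom k A (Localization.AtPrime p.asIdeal))

theorem toLocalThickening_eq_zero_iff {I : Ideal A} {p : PrimeSpectrum A} {n : ℕ} {x : A} :
    toLocalThickening k I p n x = 0 ↔
      algebraMap A (Localization.AtPrime p.asIdeal) x ∈ I.localThickening p n :=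
  Quotient.eq_zero_iff_mem

/-- The target kills t * x, and its two factors are killed by powers of the maximal ideals, so by
dévissage the regularity of t on the residue fields allows t to be cancelled. -/
theorem map_toLocalThickening_eq_zero {p : PrimeSpectrum A} {q : PrimeSpectrum B}
    {t x : A ⊗[k] B} (ht : residueTensor k p q t ∈ nonZeroDivisors _) {I : Ideal A} {J : Ideal B}
    (hx : t * x ∈ I.extendLeft k B ⊔ J.extendRight k A) (a b : ℕ) :
    Algebra.TensorProduct.map (toLocalThickening k I p a) (toLocalThickening k J q b) x = 0 := by
  set φ := Algebra.TensorProduct.map (toLocalThickening k I p a) (toLocalThickening k J q b)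
    with hφ
  let t' : Localization.AtPrime p.asIdeal ⊗[k] Localization.AtPrime q.asIdeal :=
    Algebra.TensorProduct.map (IsScalarTower.toAlgHom k A _) (IsScalarTower.toAlgHom k B _) t
  have h0 : φ (t * x) = 0 := by
    rw [← RingHom.mem_ker]
    refine (sup_le ?_ ?_ : I.extendLeft k B ⊔ J.extendRight k A ≤ RingHom.ker φ) hx
    · refine map_le_iff_le_comap.2 fun y hy => ?_
      have : toLocalThickening k I p a y = 0 := toLocalThickening_eq_zero_iff.2
        (mem_sup_left (mem_map_of_mem _ hy))
      simp [hφ, RingHom.mem_ker, this]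
    · refine map_le_iff_le_comap.2 fun y hy => ?_
      have : toLocalThickening k J q b y = 0 := toLocalThickening_eq_zero_iff.2
        (mem_sup_left (mem_map_of_mem _ hy))
      simp [hφ, RingHom.mem_ker, this]
  have hinj : Function.Injective (TensorProduct.actHom k (Localization.AtPrime p.asIdeal)
      (Localization.AtPrime q.asIdeal)
      (Localization.AtPrime p.asIdeal ⧸ I.localThickening p a)
      (Localization.AtPrime q.asIdeal ⧸ J.localThickening q b) t') := by
    refine TensorProduct.actHom_injective_of_quotient_maximal
      (IsLocalRing.maximalIdeal (Localization.AtPrime p.asIdeal))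
      (IsLocalRing.maximalIdeal (Localization.AtPrime q.asIdeal)) t' ?_ a b ?_ ?_
    · refine (TensorProduct.actHom_injective_iff_mem_nonZeroDivisors t').2 ?_
      have h : Algebra.TensorProduct.map
          (IsScalarTower.toAlgHom k (Localization.AtPrime p.asIdeal) p.asIdeal.ResidueField)
          (IsScalarTower.toAlgHom k (Localization.AtPrime q.asIdeal) q.asIdeal.ResidueField) t' =
          residueTensor k p q t :=
        Algebra.TensorProduct.map_map_apply _ _ _ _ t
      rw [← h] at ht
      exact ht
    · intro y hy v
      obtain ⟨v, rfl⟩ := Quotient.mk_surjective v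
      exact Quotient.eq_zero_iff_mem.2 (mul_mem_right v _ (mem_sup_right hy))
    · intro y hy v
      obtain ⟨v, rfl⟩ := Quotient.mk_surjective v
      exact Quotient.eq_zero_iff_mem.2 (mul_mem_right v _ (mem_sup_right hy))
  refine hinj ?_
  rw [map_zero]
  refine (TensorProduct.actHom_eq_mul t' (φ x)).trans ?_
  rw [← h0, map_mul]
  congr 1
  exact Algebra.TensorProduct.map_map_apply _ _ _ _ t

end Tensor

/-- The `s`-th symbolic power of `I` with respect to a set of primes. -/
def symbolicPowerOn {A : Type*} [CommRing A] (X : Set (PrimeSpectrum A)) (I : Ideal A) (s : ℕ) :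
    Ideal A :=
  ⨅ p ∈ X, (I ^ s).localContraction p

/-! ### Symbolic powers with respect to sets of primes -/

section SymbolicPower

variable {k A B : Type*} [Field k] [CommRing A] [CommRing B] [Algebra k A] [Algebra k B]

theorem mem_symbolicPowerOn {X : Set (PrimeSpectrum A)} {I : Ideal A} {s : ℕ} {x : A} :
    x ∈ symbolicPowerOn X I s ↔ ∀ p ∈ X, ∃ u ∉ p.asIdeal, u * x ∈ I ^ s := by
  simp [symbolicPowerOn, Submodule.mem_iInf, mem_localContraction]

theorem symbolicPowerOn_antitone (X : Set (PrimeSpectrum A)) (I : Ideal A) :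
    Antitone (symbolicPowerOn X I) := fun _ _ h =>
  iInf₂_mono fun p _ => localContraction_mono (pow_le_pow_right h) p

theorem symbolicPowerOn_zero (X : Set (PrimeSpectrum A)) (I : Ideal A) :
    symbolicPowerOn X I 0 = ⊤ := by
  refine eq_top_iff.2 fun x _ => mem_symbolicPowerOn.2 fun p _ => ⟨1, ?_, by simp⟩
  exact (ne_top_iff_one _).1 p.2.ne_top

/-- Modulo its symbolic power, each ring maps jointly injectively to the thickenings at its chosen
primes. Membership can thus be tested on one pair of thickenings at a time, with t depending on the
pair of primes. -/
theorem mem_extendLeft_sup_extendRight_of_mul_mem [IsNoetherianRing A] [IsNoetherianRing B]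
    {X : Set (PrimeSpectrum A)} {Y : Set (PrimeSpectrum B)} {I : Ideal A} {J : Ideal B}
    {i j : ℕ} {x : A ⊗[k] B}
    (h : ∀ p ∈ X, ∀ q ∈ Y, ∃ t, residueTensor k p q t ∈ nonZeroDivisors _ ∧
      t * x ∈ (I ^ i).extendLeft k B ⊔ (J ^ j).extendRight k A) :
    x ∈ (symbolicPowerOn X I i).extendLeft k B ⊔ (symbolicPowerOn Y J j).extendRight k A := by
  rw [extendLeft_sup_extendRight, RingHom.mem_ker]
  let f (c : X × ℕ) : (A ⧸ symbolicPowerOn X I i) →ₐ[k]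
      Localization.AtPrime c.1.1.asIdeal ⧸ (I ^ i).localThickening c.1.1 c.2 :=
    Quotient.liftₐ _ (toLocalThickening k (I ^ i) c.1.1 c.2) fun y hy =>
      toLocalThickening_eq_zero_iff.2 (localContraction_le_comap_localThickening _ _ _
        ((iInf₂_le c.1.1 c.1.2 : symbolicPowerOn X I i ≤ _) hy))
  let g (c : Y × ℕ) : (B ⧸ symbolicPowerOn Y J j) →ₐ[k]
      Localization.AtPrime c.1.1.asIdeal ⧸ (J ^ j).localThickening c.1.1 c.2 :=
    Quotient.liftₐ _ (toLocalThickening k (J ^ j) c.1.1 c.2) fun y hy =>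
      toLocalThickening_eq_zero_iff.2 (localContraction_le_comap_localThickening _ _ _
        ((iInf₂_le c.1.1 c.1.2 : symbolicPowerOn Y J j ≤ _) hy))
  refine TensorProduct.eq_zero_of_forall_map_eq_zero (fun c => (f c).toLinearMap) ?_
    (fun c => (g c).toLinearMap) ?_ _ fun c d => ?_
  · intro v hv
    obtain ⟨v, rfl⟩ := Quotient.mk_surjective v
    refine Quotient.eq_zero_iff_mem.2 (mem_iInf.2 fun p => mem_iInf.2 fun hp => ?_)
    exact mem_localContraction_of_forall fun n =>
      toLocalThickening_eq_zero_iff.1 (hv (⟨p, hp⟩, n))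
  · intro v hv
    obtain ⟨v, rfl⟩ := Quotient.mk_surjective v
    refine Quotient.eq_zero_iff_mem.2 (mem_iInf.2 fun p => mem_iInf.2 fun hp => ?_)
    exact mem_localContraction_of_forall fun n =>
      toLocalThickening_eq_zero_iff.1 (hv (⟨p, hp⟩, n))
  · obtain ⟨t, ht, htx⟩ := h c.1.1 c.1.2 d.1.1 d.1.2
    rw [← map_toLocalThickening_eq_zero ht htx c.2 d.2]
    exact Algebra.TensorProduct.map_map_apply (Quotient.mkₐ k _) (f c) (Quotient.mkₐ k _) (g d) x

/-- The binomial expansion of symbolic powers with respect to compatible sets of primes. -/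
theorem symbolicPowerOn_add [IsNoetherianRing A] [IsNoetherianRing B]
    {X : Set (PrimeSpectrum A)} {Y : Set (PrimeSpectrum B)} {Z : Set (PrimeSpectrum (A ⊗[k] B))}
    (hZ : Z.Finite) (I : Ideal A) (J : Ideal B)
    (hX : ∀ P ∈ Z, ∃ p ∈ X, P.asIdeal.comap
      (Algebra.TensorProduct.includeLeft : A →ₐ[k] A ⊗[k] B) ≤ p.asIdeal)
    (hY : ∀ P ∈ Z, ∃ q ∈ Y, P.asIdeal.comap
      (Algebra.TensorProduct.includeRight : B →ₐ[k] A ⊗[k] B) ≤ q.asIdeal)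
    (hreg : ∀ t, (∀ P ∈ Z, t ∉ P.asIdeal) → ∀ p ∈ X, ∀ q ∈ Y,
      residueTensor k p q t ∈ nonZeroDivisors _) (s : ℕ) :
    symbolicPowerOn Z (I.extendLeft k B + J.extendRight k A) s =
      ∑ i ∈ Finset.range (s + 1),
        (symbolicPowerOn X I i).extendLeft k B * (symbolicPowerOn Y J (s - i)).extendRight k A := by
  apply le_antisymm
  · intro x hx
    -- C is the colon ideal ((I + J)^s : x). Contained in no P of the finite set Z, it is not
    -- contained in their union.
    let C : Ideal (A ⊗[k] B) :=
      Submodule.comap (LinearMap.mulRight (A ⊗[k] B) x) ((I.extendLeft k B + J.extendRight k A) ^ s)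
    obtain ⟨t, htx, htZ⟩ : ∃ t, t * x ∈ (I.extendLeft k B + J.extendRight k A) ^ s ∧
        ∀ P ∈ Z, t ∉ P.asIdeal := by
      by_contra! hcon
      have hsub : (C : Set (A ⊗[k] B)) ⊆ ⋃ P ∈ Z, (P.asIdeal : Set (A ⊗[k] B)) := by
        intro t ht
        obtain ⟨P, hP, htP⟩ := hcon t ht
        exact Set.mem_biUnion hP htP
      rcases Z.eq_empty_or_nonempty with rfl | ⟨P₀, -⟩
      · simpa using hsub (zero_mem C)
      obtain ⟨P, hP, hCP⟩ := (subset_union_prime_finite hZ (f := PrimeSpectrum.asIdeal) P₀ P₀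
        fun P _ _ _ => P.2).1 hsub
      obtain ⟨u, hu, hux⟩ := mem_symbolicPowerOn.1 hx P hP
      exact hu (hCP hux)
    refine mem_sum_mul_of_forall_mem_sup
      (V := fun i => (symbolicPowerOn X I i).extendLeft k B)
      (W := fun j => (symbolicPowerOn Y J j).extendRight k A)
      (fun _ _ h => extendRight_mono (symbolicPowerOn_antitone Y J h))
      (fun _ _ h => extendLeft_mono (symbolicPowerOn_antitone X I h))
      (by simp [symbolicPowerOn_zero, extendLeft, map_top])
      (by simp [symbolicPowerOn_zero, extendRight, map_top])
      (fun _ _ => (extendLeft_inf_extendRight _ _).le) fun i hi => ?_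
    refine mem_extendLeft_sup_extendRight_of_mul_mem fun p hp q hq =>
      ⟨t, hreg t htZ p hp q hq, ?_⟩
    rw [extendLeft_pow, extendRight_pow]
    have hle := add_pow_add_le (I.extendLeft k B) (J.extendRight k A) i (s - i)
    rw [Nat.add_sub_cancel' hi.le] at hle
    exact hle htx
  · rw [sum_eq_sup]
    refine Finset.sup_le fun i hi => ?_
    rw [extendLeft, extendRight, ← Ideal.span_eq (symbolicPowerOn X I i),
      ← Ideal.span_eq (symbolicPowerOn Y J (s - i)), map_span, map_span, span_mul_span', span_le]
    rintro _ ⟨_, ⟨x, hx, rfl⟩, _, ⟨y, hy, rfl⟩, rfl⟩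
    refine mem_symbolicPowerOn.2 fun P hP => ?_
    obtain ⟨p, hp, hPp⟩ := hX P hP
    obtain ⟨q, hq, hPq⟩ := hY P hP
    obtain ⟨u, hu, hux⟩ := mem_symbolicPowerOn.1 hx p hp
    obtain ⟨v, hv, hvy⟩ := mem_symbolicPowerOn.1 hy q hq
    -- Neither factor lies in P, since P contracts into p and into q.
    refine ⟨(u ⊗ₜ 1) * (1 ⊗ₜ v), fun h => ?_, ?_⟩
    · exact (P.2.mem_or_mem h).elim (fun h => hu (hPp h)) fun h => hv (hPq h)
    · have hi' : s = i + (s - i) := by have := Finset.mem_range.1 hi; omega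
      have h1 : (u * x) ⊗ₜ[k] (1 : B) ∈ (I.extendLeft k B + J.extendRight k A) ^ i := by
        refine pow_right_mono le_sup_left i ?_
        rw [← extendLeft_pow]
        exact mem_map_of_mem Algebra.TensorProduct.includeLeft hux
      have h2 : (1 : A) ⊗ₜ[k] (v * y) ∈ (I.extendLeft k B + J.extendRight k A) ^ (s - i) := by
        refine pow_right_mono le_sup_right _ ?_
        rw [← extendRight_pow]
        exact mem_map_of_mem Algebra.TensorProduct.includeRight hvy
      have h3 := mul_mem_mul h1 h2
      rw [← pow_add, ← hi'] at h3
      simpa using h3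

end SymbolicPower

end Ideal

/-! ### Tensor products of fields are unmixed -/

section UnmixedTensor

/-- In a torsion-free integral extension of a domain, an element outside of the minimal primes is
not a zero divisor. -/
theorem mem_nonZeroDivisors_of_forall_notMem_minimalPrimes_of_isIntegral {D S : Type*} [CommRing D]
    [IsDomain D] [CommRing S] [Algebra D S] [Algebra.IsIntegral D S] [Module.IsTorsionFree D S]
    {t : S} (ht : ∀ Q ∈ minimalPrimes S, t ∉ Q) : t ∈ nonZeroDivisors S := by
  rw [mem_nonZeroDivisors_iff_left]
  intro z hz
  by_contra hz0
  let N : Submonoid S := (nonZeroDivisors D).map (algebraMap D S)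
  let C : Ideal S := Submodule.comap (LinearMap.mulRight S z) ⊥
  have hC : ∀ {x}, x ∈ C ↔ x * z = 0 := fun {x} => Iff.rfl
  -- The annihilator C of z meets D only in 0 by torsion-freeness, so some prime Q ⊇ C lies over 0.
  -- Incomparability in integral extensions makes Q minimal.
  have hdisj : Disjoint (C : Set S) N := by
    rw [Set.disjoint_left]
    rintro _ hx ⟨d, hd, rfl⟩
    rw [SetLike.mem_coe, hC, ← Algebra.smul_def, smul_eq_zero] at hx
    exact hx.elim (nonZeroDivisors.ne_zero hd) hz0
  obtain ⟨Q, hQ, hCQ, hQN⟩ := Ideal.exists_le_prime_disjoint C N hdisj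
  refine ht Q ⟨⟨hQ, bot_le⟩, fun Q' ⟨hQ', _⟩ hle => ?_⟩ (hCQ (hC.2 hz))
  by_contra hnot
  have hlt := Ideal.IsIntegral.comap_lt_comap (R := D) (lt_of_le_not_ge hle hnot)
  refine hlt.not_ge fun d hd => ?_
  by_cases hd0 : d = 0
  · simp [hd0]
  · exact absurd ⟨d, mem_nonZeroDivisors_of_ne_zero hd0, rfl⟩ (Set.disjoint_left.1 hQN hd)

/-- Clearing denominators in a tensor product. -/
theorem Algebra.TensorProduct.exists_mul_eq_map {k A A' B B' : Type*} [CommRing k]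
    [CommRing A] [CommRing A'] [CommRing B] [CommRing B']
    [Algebra k A] [Algebra k A'] [Algebra k B] [Algebra k B']
    (f : A →ₐ[k] A') (g : B →ₐ[k] B') {S : Submonoid A} {T : Submonoid B}
    (hf : ∀ x, ∃ d ∈ S, ∃ a, f d * x = f a) (hg : ∀ x, ∃ d ∈ T, ∃ b, g d * x = g b)
    (z : A' ⊗[k] B') : ∃ d ∈ S, ∃ e ∈ T, ∃ y, map f g (d ⊗ₜ e) * z = map f g y := by
  induction z with
  | zero => exact ⟨1, S.one_mem, 1, T.one_mem, 0, by simp⟩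
  | tmul x y =>
    obtain ⟨d, hd, a, ha⟩ := hf x
    obtain ⟨e, he, b, hb⟩ := hg y
    exact ⟨d, hd, e, he, a ⊗ₜ b, by simp [ha, hb]⟩
  | add z w hz hw =>
    obtain ⟨d, hd, e, he, y, hy⟩ := hz
    obtain ⟨d', hd', e', he', y', hy'⟩ := hw
    refine ⟨d * d', S.mul_mem hd hd', e * e', T.mul_mem he he',
      d' ⊗ₜ e' * y + d ⊗ₜ e * y', ?_⟩
    rw [← Algebra.TensorProduct.tmul_mul_tmul, map_add, map_mul, map_mul, map_mul, ← hy, ← hy']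
    ring

/-- If `P ⊗[k] L` is a domain, then so is `E ⊗[k] L` for the fraction field `E` of `P`. -/
theorem Algebra.TensorProduct.isDomain_of_forall_exists_mul_eq {k P E L : Type*} [Field k]
    [CommRing P] [IsDomain P] [Field E] [Field L] [Algebra k P] [Algebra k E] [Algebra k L]
    [IsDomain (P ⊗[k] L)] (f : P →ₐ[k] E) (hf : Function.Injective f)
    (hfrac : ∀ e : E, ∃ d ∈ nonZeroDivisors P, ∃ a, f d * e = f a) : IsDomain (E ⊗[k] L) := by
  let φ : P ⊗[k] L →ₐ[k] E ⊗[k] L := Algebra.TensorProduct.map f (AlgHom.id k L)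
  have hφ : Function.Injective φ :=
    Module.Flat.rTensor_preserves_injective_linearMap (M := L) f.toLinearMap hf
  have hclear : ∀ z : E ⊗[k] L, ∃ u y, IsUnit u ∧ u * z = φ y := by
    intro z
    -- The factor L needs no denominators, hence the trivial submonoid.
    obtain ⟨d, hd, e, he, y, hy⟩ := Algebra.TensorProduct.exists_mul_eq_map f (AlgHom.id k L)
      (T := ⊥) hfrac (fun b => ⟨1, one_mem _, b, by simp⟩) z
    obtain rfl : e = 1 := he
    refine ⟨_, y, ?_, hy⟩
    have : IsUnit (f d) := isUnit_iff_ne_zero.2 fun h =>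
      nonZeroDivisors.ne_zero hd (hf (by rw [h, map_zero]))
    simpa using this.map (Algebra.TensorProduct.includeLeft : E →ₐ[k] E ⊗[k] L)
  have : NoZeroDivisors (E ⊗[k] L) := by
    refine ⟨fun {z w} hzw => ?_⟩
    obtain ⟨u, y, hu, hy⟩ := hclear z
    obtain ⟨u', y', hu', hy'⟩ := hclear w
    have h0 : φ (y * y') = 0 := by
      rw [map_mul, ← hy, ← hy']
      linear_combination u * u' * hzw
    rcases mul_eq_zero.1 ((map_eq_zero_iff φ hφ).1 h0) with h | h
    · left
      rwa [h, map_zero, hu.mul_right_eq_zero] at hy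
    · right
      rwa [h, map_zero, hu'.mul_right_eq_zero] at hy'
  exact NoZeroDivisors.to_isDomain _

/-- The adjoined field is the fraction field of a polynomial ring over k, whose tensor product with
L is a polynomial ring over L. -/
theorem AlgebraicIndependent.isDomain_adjoin_tensorProduct {k K L ι : Type*} [Field k] [Field K]
    [Field L] [Algebra k K] [Algebra k L] {x : ι → K} (hx : AlgebraicIndependent k x) :
    IsDomain (IntermediateField.adjoin k (Set.range x) ⊗[k] L) := by
  let y (i : ι) : IntermediateField.adjoin k (Set.range x) :=
    ⟨x i, IntermediateField.subset_adjoin k _ ⟨i, rfl⟩⟩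
  let f : MvPolynomial ι k →ₐ[k] IntermediateField.adjoin k (Set.range x) := MvPolynomial.aeval y
  have hval : ∀ r, (f r : K) = MvPolynomial.aeval x r := fun r =>
    (MvPolynomial.map_aeval y (algebraMap (IntermediateField.adjoin k (Set.range x)) K) r).trans rfl
  have hf : Function.Injective f := fun a b h => hx (by
    change MvPolynomial.aeval x a = MvPolynomial.aeval x b
    rw [← hval, ← hval, h])
  have hdom : IsDomain (MvPolynomial ι k ⊗[k] L) :=
    ((Algebra.TensorProduct.comm k (MvPolynomial ι k) L).toRingEquiv.trans
      (MvPolynomial.algebraTensorAlgEquiv k L).toRingEquiv).toMulEquiv.isDomain _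
  refine Algebra.TensorProduct.isDomain_of_forall_exists_mul_eq f hf ?_
  rintro ⟨e, he⟩
  obtain ⟨r, s, hrs⟩ := (IntermediateField.mem_adjoin_range_iff k x e).1 he
  -- The presentation of e as a quotient allows s = 0; then e = 0, since division by zero gives
  -- zero.
  by_cases hs : s = 0
  · refine ⟨1, one_mem _, 0, Subtype.ext ?_⟩
    simp [hrs, hs]
  · refine ⟨s, mem_nonZeroDivisors_of_ne_zero hs, r, Subtype.ext ?_⟩
    have : MvPolynomial.aeval x s ≠ 0 := fun h => hs (hx (by rw [h, map_zero]))
    simp only [MulMemClass.coe_mul, hval, hrs]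
    field_simp

/-- K ⊗ L is the base change of the integral extension K / E to the domain E ⊗ L, hence integral and
torsion-free over it. -/
theorem Algebra.TensorProduct.mem_nonZeroDivisors_of_isDomain_of_isIntegral {k E K L : Type*}
    [Field k] [Field E] [Field K] [Field L] [Algebra k E] [Algebra k K] [Algebra k L]
    [Algebra E K] [IsScalarTower k E K] [Algebra.IsIntegral E K] [IsDomain (E ⊗[k] L)]
    {t : K ⊗[k] L} (ht : ∀ Q ∈ minimalPrimes (K ⊗[k] L), t ∉ Q) :
    t ∈ nonZeroDivisors (K ⊗[k] L) := by
  let e : (E ⊗[k] L) ⊗[E] K ≃+* K ⊗[k] L :=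
    (Algebra.TensorProduct.comm E (E ⊗[k] L) K).toRingEquiv.trans
      (Algebra.TensorProduct.cancelBaseChange k E E K L).toRingEquiv
  have key : e.symm t ∈ nonZeroDivisors ((E ⊗[k] L) ⊗[E] K) := by
    refine mem_nonZeroDivisors_of_forall_notMem_minimalPrimes_of_isIntegral (D := E ⊗[k] L)
      fun Q hQ htQ => ht (Q.comap e.symm) ⟨⟨?_, bot_le⟩, fun Q' ⟨hQ', _⟩ hle => ?_⟩ htQ
    · have := hQ.1.1
      exact Ideal.comap_isPrime _ _
    · have h1 : Q'.comap e ≤ Q := fun y hy => by simpa using hle hy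
      have h2 := hQ.2 ⟨Ideal.comap_isPrime (e : _ →+* _) Q', bot_le⟩ h1
      intro y hy
      have h3 : e (e.symm y) ∈ Q' := h2 hy
      rwa [e.apply_symm_apply] at h3
  rw [mem_nonZeroDivisors_iff_left] at key ⊢
  intro z hz
  have := key (e.symm z) (by rw [← map_mul, hz, map_zero])
  simpa using this

/-- In the tensor product of two fields, an element outside of the minimal primes is not a zero
divisor. -/
theorem Algebra.TensorProduct.mem_nonZeroDivisors_of_forall_notMem_minimalPrimes {k K L : Type*}
    [Field k] [Field K] [Field L] [Algebra k K] [Algebra k L] {t : K ⊗[k] L}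
    (ht : ∀ Q ∈ minimalPrimes (K ⊗[k] L), t ∉ Q) : t ∈ nonZeroDivisors (K ⊗[k] L) := by
  obtain ⟨ι, x, hx⟩ := exists_isTranscendenceBasis' k K
  have : Algebra.IsAlgebraic (IntermediateField.adjoin k (Set.range x)) K := hx.isAlgebraic_field
  have := AlgebraicIndependent.isDomain_adjoin_tensorProduct (L := L) hx.1
  exact mem_nonZeroDivisors_of_isDomain_of_isIntegral
    (E := IntermediateField.adjoin k (Set.range x)) ht

end UnmixedTensor

namespace Ideal

/-! ### Regularity on tensor products of residue fields -/

section ResidueTensor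

variable {k A B : Type*} [Field k] [CommRing A] [CommRing B] [Algebra k A] [Algebra k B]

theorem exists_algebraMap_residueField_mul_eq (p : PrimeSpectrum A) (x : p.asIdeal.ResidueField) :
    ∃ d ∈ p.asIdeal.primeCompl, ∃ a, algebraMap A p.asIdeal.ResidueField d * x =
      algebraMap A p.asIdeal.ResidueField a := by
  obtain ⟨⟨a, d, hd⟩, h⟩ := IsLocalization.surj (nonZeroDivisors (A ⧸ p.asIdeal)) x
  obtain ⟨a, rfl⟩ := Quotient.mk_surjective a
  obtain ⟨d, rfl⟩ := Quotient.mk_surjective d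
  refine ⟨d, fun hdp => nonZeroDivisors.ne_zero hd (Quotient.eq_zero_iff_mem.2 hdp), a, ?_⟩
  rw [mul_comm]
  exact h

theorem isUnit_algebraMap_residueField {p : PrimeSpectrum A} {d : A} (hd : d ∉ p.asIdeal) :
    IsUnit (algebraMap A p.asIdeal.ResidueField d) :=
  isUnit_iff_ne_zero.2 fun h => hd (algebraMap_residueField_eq_zero.1 h)

theorem isUnit_residueTensor_tmul {p : PrimeSpectrum A} {q : PrimeSpectrum B} {a : A} {b : B}
    (ha : a ∉ p.asIdeal) (hb : b ∉ q.asIdeal) : IsUnit (residueTensor k p q (a ⊗ₜ b)) := by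
  have h1 := (isUnit_algebraMap_residueField ha).map (Algebra.TensorProduct.includeLeft :
    p.asIdeal.ResidueField →ₐ[k] p.asIdeal.ResidueField ⊗[k] q.asIdeal.ResidueField)
  have h2 := (isUnit_algebraMap_residueField hb).map (Algebra.TensorProduct.includeRight :
    q.asIdeal.ResidueField →ₐ[k] p.asIdeal.ResidueField ⊗[k] q.asIdeal.ResidueField)
  simpa [residueTensor] using h1.mul h2

theorem exists_isUnit_mul_eq_residueTensor (p : PrimeSpectrum A) (q : PrimeSpectrum B)
    (z : p.asIdeal.ResidueField ⊗[k] q.asIdeal.ResidueField) :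
    ∃ u y, IsUnit u ∧ u * z = residueTensor k p q y := by
  obtain ⟨d, hd, e, he, y, hy⟩ := Algebra.TensorProduct.exists_mul_eq_map
    (IsScalarTower.toAlgHom k A _) (IsScalarTower.toAlgHom k B _)
    (exists_algebraMap_residueField_mul_eq p) (exists_algebraMap_residueField_mul_eq q) z
  exact ⟨_, y, isUnit_residueTensor_tmul hd he, hy⟩

theorem residueTensor_eq_zero_iff {p : PrimeSpectrum A} {q : PrimeSpectrum B} {y : A ⊗[k] B} :
    residueTensor k p q y = 0 ↔
      y ∈ p.asIdeal.extendLeft k B ⊔ q.asIdeal.extendRight k A := by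
  let f := IsScalarTower.toAlgHom k (A ⧸ p.asIdeal) p.asIdeal.ResidueField
  let g := IsScalarTower.toAlgHom k (B ⧸ q.asIdeal) q.asIdeal.ResidueField
  have hinj : Function.Injective (Algebra.TensorProduct.map f g) :=
    TensorProduct.map_injective_of_flat_flat f.toLinearMap g.toLinearMap
      (IsFractionRing.injective (A ⧸ p.asIdeal) p.asIdeal.ResidueField)
      (IsFractionRing.injective (B ⧸ q.asIdeal) q.asIdeal.ResidueField)
  have h : Algebra.TensorProduct.map f g (Algebra.TensorProduct.map (Quotient.mkₐ k p.asIdeal)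
      (Quotient.mkₐ k q.asIdeal) y) = residueTensor k p q y :=
    Algebra.TensorProduct.map_map_apply _ _ _ _ y
  rw [extendLeft_sup_extendRight, RingHom.mem_ker, ← h, map_eq_zero_iff _ hinj]

/-- The residue tensor is a localization of A/p ⊗ B/q, so up to units its elements come from A ⊗ B.
-/
theorem residueTensor_mem_nonZeroDivisors_iff {p : PrimeSpectrum A} {q : PrimeSpectrum B}
    {t : A ⊗[k] B} : residueTensor k p q t ∈ nonZeroDivisors _ ↔
      ∀ y, t * y ∈ p.asIdeal.extendLeft k B ⊔ q.asIdeal.extendRight k A →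
        y ∈ p.asIdeal.extendLeft k B ⊔ q.asIdeal.extendRight k A := by
  simp only [← residueTensor_eq_zero_iff, map_mul]
  rw [mem_nonZeroDivisors_iff_left]
  refine ⟨fun h y => h _, fun h z hz => ?_⟩
  obtain ⟨u, y, hu, hy⟩ := exists_isUnit_mul_eq_residueTensor p q z
  have h0 := h y (by rw [← hy]; linear_combination u * hz)
  rwa [← hy, hu.mul_right_eq_zero] at h0

end ResidueTensor

/-! ### Associated primes -/

section Associated

variable {k A B : Type*} [Field k] [CommRing A] [CommRing B] [Algebra k A] [Algebra k B]

theorem actHom_quotient_injective_iff {I : Ideal A} {J : Ideal B} {t : A ⊗[k] B} :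
    Function.Injective (TensorProduct.actHom k A B (A ⧸ I) (B ⧸ J) t) ↔
      ∀ y, t * y ∈ I.extendLeft k B ⊔ J.extendRight k A →
        y ∈ I.extendLeft k B ⊔ J.extendRight k A := by
  have hact : ∀ y, TensorProduct.actHom k A B (A ⧸ I) (B ⧸ J) t
      (Algebra.TensorProduct.map (Quotient.mkₐ k I) (Quotient.mkₐ k J) y) =
      Algebra.TensorProduct.map (Quotient.mkₐ k I) (Quotient.mkₐ k J) (t * y) := fun y => by
    rw [map_mul]
    exact TensorProduct.actHom_eq_mul t _
  simp only [extendLeft_sup_extendRight, RingHom.mem_ker]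
  rw [injective_iff_map_eq_zero]
  refine ⟨fun h y hy => h _ ((hact y).trans hy), fun h z hz => ?_⟩
  obtain ⟨y, rfl⟩ := TensorProduct.map_surjective (g := (Quotient.mkₐ k I).toLinearMap)
    (g' := (Quotient.mkₐ k J).toLinearMap) Quotient.mk_surjective Quotient.mk_surjective z
  exact h y ((hact y).symm.trans hz)

theorem isSMulRegular_quotient_iff_actHom_injective {I : Ideal A} {J : Ideal B} {t : A ⊗[k] B} :
    IsSMulRegular (A ⊗[k] B ⧸ I.extendLeft k B + J.extendRight k A) t ↔
      Function.Injective (TensorProduct.actHom k A B (A ⧸ I) (B ⧸ J) t) := by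
  rw [actHom_quotient_injective_iff, isSMulRegular_iff_right_eq_zero_of_smul]
  refine ⟨fun h y hy => ?_, fun h y => ?_⟩
  · exact Quotient.eq_zero_iff_mem.1 (h (Quotient.mk _ y) (Quotient.eq_zero_iff_mem.2 hy))
  · obtain ⟨y, rfl⟩ := Quotient.mk_surjective y
    exact fun hy => Quotient.eq_zero_iff_mem.2 (h y (Quotient.eq_zero_iff_mem.1 hy))

/-- An element outside all associated primes is regular on A/I ⊗ B/J, hence on A/p ⊗ B/q, which
embeds in it. -/
theorem residueTensor_mem_nonZeroDivisors_of_forall_notMem_associatedPrimes [IsNoetherianRing A]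
    [IsNoetherianRing B] [IsNoetherianRing (A ⊗[k] B)] {I : Ideal A} {J : Ideal B} {t : A ⊗[k] B}
    (ht : ∀ P ∈ associatedPrimes (A ⊗[k] B) (A ⊗[k] B ⧸ I.extendLeft k B + J.extendRight k A),
      t ∉ P) {p : PrimeSpectrum A} (hp : p.asIdeal ∈ associatedPrimes A (A ⧸ I))
    {q : PrimeSpectrum B} (hq : q.asIdeal ∈ associatedPrimes B (B ⧸ J)) :
    residueTensor k p q t ∈ nonZeroDivisors _ := by
  have hreg : IsSMulRegular (A ⊗[k] B ⧸ I.extendLeft k B + J.extendRight k A) t := by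
    by_contra h
    have h' : t ∈ {r | IsSMulRegular (A ⊗[k] B ⧸ I.extendLeft k B + J.extendRight k A) r}ᶜ := h
    rw [← biUnion_associatedPrimes_eq_compl_regular] at h'
    obtain ⟨P, hP, htP⟩ := Set.mem_iUnion₂.1 h'
    exact ht P hP htP
  obtain ⟨-, f, hf⟩ := (isAssociatedPrime_iff_exists_injective_linearMap _ _).1 hp
  obtain ⟨-, g, hg⟩ := (isAssociatedPrime_iff_exists_injective_linearMap _ _).1 hq
  rw [residueTensor_mem_nonZeroDivisors_iff, ← actHom_quotient_injective_iff]
  exact TensorProduct.actHom_injective_of_linearMap_injective f hf g hg t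
    (isSMulRegular_quotient_iff_actHom_injective.1 hreg)

theorem exists_associatedPrimes_comap_le [IsNoetherianRing A] {M : Type*} [AddCommGroup M]
    [Module A M] [Module.Finite A M] {P : Ideal A} (hP : ∀ a ∈ P, ¬ IsSMulRegular M a) :
    ∃ p : PrimeSpectrum A, p.asIdeal ∈ associatedPrimes A M ∧ P ≤ p.asIdeal := by
  have hsub : (P : Set A) ⊆ ⋃ p ∈ associatedPrimes A M, (p : Set A) := by
    rw [biUnion_associatedPrimes_eq_compl_regular]
    exact hP
  obtain ⟨p, hp, hPp⟩ := (subset_union_prime_finite (associatedPrimes.finite A M)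
    (f := fun p : Ideal A => p) ⊥ ⊥ fun p hp _ _ => hp.isPrime).1 hsub
  exact ⟨⟨p, hp.isPrime⟩, hp, hPp⟩

theorem not_isSMulRegular_of_mem_associatedPrimes {R M : Type*} [CommRing R] [IsNoetherianRing R]
    [AddCommGroup M] [Module R M] {P : Ideal R} (hP : P ∈ associatedPrimes R M) {a : R}
    (ha : a ∈ P) : ¬ IsSMulRegular M a := by
  have : a ∈ ⋃ p ∈ associatedPrimes R M, (p : Set R) := Set.mem_biUnion hP ha
  rwa [biUnion_associatedPrimes_eq_compl_regular] at this

/-- Elements regular on A/I stay regular on A/I ⊗ B/J by flatness. So P contracts to zero divisors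
on A/I, and prime avoidance applies. -/
theorem exists_associatedPrimes_comap_includeLeft_le [IsNoetherianRing A]
    [IsNoetherianRing (A ⊗[k] B)] {I : Ideal A} {J : Ideal B} {P : Ideal (A ⊗[k] B)}
    (hP : P ∈ associatedPrimes (A ⊗[k] B) (A ⊗[k] B ⧸ I.extendLeft k B + J.extendRight k A)) :
    ∃ p : PrimeSpectrum A, p.asIdeal ∈ associatedPrimes A (A ⧸ I) ∧
      P.comap (Algebra.TensorProduct.includeLeft : A →ₐ[k] A ⊗[k] B) ≤ p.asIdeal := by
  refine exists_associatedPrimes_comap_le fun a ha hreg =>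
    not_isSMulRegular_of_mem_associatedPrimes hP ha
      (isSMulRegular_quotient_iff_actHom_injective.2
        (TensorProduct.actHom_tmul_one_injective hreg))

theorem exists_associatedPrimes_comap_includeRight_le [IsNoetherianRing B]
    [IsNoetherianRing (A ⊗[k] B)] {I : Ideal A} {J : Ideal B} {P : Ideal (A ⊗[k] B)}
    (hP : P ∈ associatedPrimes (A ⊗[k] B) (A ⊗[k] B ⧸ I.extendLeft k B + J.extendRight k A)) :
    ∃ q : PrimeSpectrum B, q.asIdeal ∈ associatedPrimes B (B ⧸ J) ∧
      P.comap (Algebra.TensorProduct.includeRight : B →ₐ[k] A ⊗[k] B) ≤ q.asIdeal := by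
  refine exists_associatedPrimes_comap_le fun b hb hreg =>
    not_isSMulRegular_of_mem_associatedPrimes hP hb
      (isSMulRegular_quotient_iff_actHom_injective.2
        (TensorProduct.actHom_one_tmul_injective hreg))

end Associated

/-! ### Minimal primes -/

section Minimal

/-- Write p = (√I : x). A minimal prime of I that misses x contains p, hence equals p. -/
theorem mem_minimalPrimes_of_mem_associatedPrimes_radical {A : Type*} [CommRing A]
    [IsNoetherianRing A] {I p : Ideal A} (hp : p ∈ associatedPrimes A (A ⧸ I.radical)) :
    p ∈ I.minimalPrimes := by
  obtain ⟨hprime, x, hx⟩ := isAssociatedPrime_iff.1 hp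
  obtain ⟨x, rfl⟩ := Quotient.mk_surjective x
  have hmem : ∀ a, a ∈ p ↔ a * x ∈ I.radical := fun a => by
    rw [hx, Submodule.mem_colon_singleton, Submodule.mem_bot]
    exact Quotient.eq_zero_iff_mem
  have hx' : x ∉ I.radical := fun h =>
    hprime.ne_top ((eq_top_iff_one p).2 ((hmem 1).2 (by rwa [one_mul])))
  rw [← sInf_minimalPrimes, Submodule.mem_sInf] at hx'
  push Not at hx'
  obtain ⟨p₁, hp₁, hxp₁⟩ := hx'
  have hle : p ≤ p₁ := fun a ha => by
    have h := (hmem a).1 ha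
    rw [← sInf_minimalPrimes, Submodule.mem_sInf] at h
    exact (hp₁.1.1.mem_or_mem (h p₁ hp₁)).resolve_right hxp₁
  have hIp : I ≤ p := fun a ha => (hmem a).2 (I.radical.mul_mem_right x (le_radical ha))
  rwa [le_antisymm hle (hp₁.2 ⟨hprime, hIp⟩ hle)]

theorem minimalPrimes_subset_associatedPrimes_quotient {A : Type*} [CommRing A]
    [IsNoetherianRing A] (I : Ideal A) : I.minimalPrimes ⊆ associatedPrimes A (A ⧸ I) := by
  have h := Module.associatedPrimes.minimalPrimes_annihilator_subset_associatedPrimes A (A ⧸ I)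
  rwa [annihilator_quotient] at h

variable {k A B : Type*} [Field k] [CommRing A] [CommRing B] [Algebra k A] [Algebra k B]

theorem minimalPrimes_extend_radical (I : Ideal A) (J : Ideal B) :
    (I.radical.extendLeft k B + J.radical.extendRight k A).minimalPrimes =
      (I.extendLeft k B + J.extendRight k A).minimalPrimes := by
  rw [← radical_minimalPrimes, ← radical_minimalPrimes (I := I.extendLeft k B + _)]
  congr 1
  refine le_antisymm (radical_le_radical_iff.2 (sup_le ?_ ?_)) (radical_mono (sup_le_sup
    (extendLeft_mono (k := k) (B := B) (le_radical (I := I)))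
    (extendRight_mono (k := k) (A := A) (le_radical (I := J)))))
  · exact (map_radical_le _).trans (radical_mono le_sup_left)
  · exact (map_radical_le _).trans (radical_mono le_sup_right)

/-- Passing to radicals keeps the minimal primes of the sum, while A/√I has only minimal primes of I
as associated primes. The contraction result for associated primes thus also serves minimal primes.
-/
theorem mem_associatedPrimes_extend_radical [IsNoetherianRing (A ⊗[k] B)] {I : Ideal A}
    {J : Ideal B} {P : Ideal (A ⊗[k] B)}
    (hP : P ∈ (I.extendLeft k B + J.extendRight k A).minimalPrimes) :
    P ∈ associatedPrimes (A ⊗[k] B)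
      (A ⊗[k] B ⧸ I.radical.extendLeft k B + J.radical.extendRight k A) :=
  minimalPrimes_subset_associatedPrimes_quotient _ (by rwa [minimalPrimes_extend_radical])

theorem residueTensor_mem_nonZeroDivisors_of_forall_notMem_minimalPrimes {I : Ideal A}
    {J : Ideal B} {t : A ⊗[k] B}
    (ht : ∀ P ∈ (I.extendLeft k B + J.extendRight k A).minimalPrimes, t ∉ P)
    {p : PrimeSpectrum A} (hp : p.asIdeal ∈ I.minimalPrimes)
    {q : PrimeSpectrum B} (hq : q.asIdeal ∈ J.minimalPrimes) :
    residueTensor k p q t ∈ nonZeroDivisors _ := by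
  refine Algebra.TensorProduct.mem_nonZeroDivisors_of_forall_notMem_minimalPrimes
    fun Q hQ htQ => ?_
  have hQprime : Q.IsPrime := hQ.1.1
  have hker : p.asIdeal.extendLeft k B ⊔ q.asIdeal.extendRight k A ≤ Q.comap (residueTensor k p q) :=
    fun y hy => by
      rw [mem_comap, residueTensor_eq_zero_iff.2 hy]
      exact zero_mem Q
  obtain ⟨P, hP, hPQ⟩ := exists_minimalPrimes_le (I := I.extendLeft k B + J.extendRight k A)
    (J := Q.comap (residueTensor k p q))
    ((sup_le_sup (extendLeft_mono hp.1.2) (extendRight_mono hq.1.2)).trans hker)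
  have hPprime : P.IsPrime := hP.1.1
  -- Elements outside p become units in the residue tensor, so P contracts into p; minimality of p
  -- over I then gives equality.
  have hpP : p.asIdeal ≤ P.comap (Algebra.TensorProduct.includeLeft : A →ₐ[k] A ⊗[k] B) := by
    refine hp.2 ⟨comap_isPrime _ _, map_le_iff_le_comap.1 (le_sup_left.trans hP.1.2)⟩
      fun a ha => ?_
    by_contra hap
    exact hQprime.ne_top (eq_top_of_isUnit_mem _ (hPQ ha)
      (isUnit_residueTensor_tmul hap ((ne_top_iff_one _).1 q.2.ne_top)))
  have hqP : q.asIdeal ≤ P.comap (Algebra.TensorProduct.includeRight : B →ₐ[k] A ⊗[k] B) := by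
    refine hq.2 ⟨comap_isPrime _ _, map_le_iff_le_comap.1 (le_sup_right.trans hP.1.2)⟩
      fun b hb => ?_
    by_contra hbq
    exact hQprime.ne_top (eq_top_of_isUnit_mem _ (hPQ hb)
      (isUnit_residueTensor_tmul ((ne_top_iff_one _).1 p.2.ne_top) hbq))
  have hle : p.asIdeal.extendLeft k B ⊔ q.asIdeal.extendRight k A ≤ P :=
    sup_le (map_le_iff_le_comap.2 hpP) (map_le_iff_le_comap.2 hqP)
  have hPmin : P ∈ ((⊥ : Ideal _).comap (residueTensor k p q).toRingHom).minimalPrimes := by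
    refine ⟨⟨hPprime, fun y hy => hle (residueTensor_eq_zero_iff.1 hy)⟩, fun P' hP' hP'P => ?_⟩
    refine hP.2 ⟨hP'.1, (sup_le_sup (extendLeft_mono hp.1.2) (extendRight_mono hq.1.2)).trans
      fun y hy => hP'.2 (residueTensor_eq_zero_iff.2 hy)⟩ hP'P
  -- P is minimal over the kernel, so it is the contraction of a prime Q'. Clearing denominators
  -- gives Q' ≤ Q, and minimality of Q gives Q ≤ Q', so t lies in P.
  obtain ⟨Q', hQ', -, hQ'P⟩ := exists_comap_eq_of_mem_minimalPrimes
    (residueTensor k p q).toRingHom P hPmin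
  have hmem : ∀ y, residueTensor k p q y ∈ Q' ↔ y ∈ P := fun y => by
    rw [← hQ'P, mem_comap]
    exact Iff.rfl
  refine ht P hP ((hmem t).1 (hQ.2 ⟨hQ', bot_le⟩ (fun z hz => ?_) htQ))
  obtain ⟨u, y, hu, hy⟩ := exists_isUnit_mul_eq_residueTensor p q z
  have huz' : u * z ∈ Q' := Q'.mul_mem_left u hz
  rw [hy, hmem] at huz'
  have huz : u * z ∈ Q := by
    rw [hy]
    exact hPQ huz'
  exact (hQprime.mem_or_mem huz).resolve_left
    fun h => hQprime.ne_top (eq_top_of_isUnit_mem _ h hu)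

end Minimal

end Ideal

/-! ### The two binomial expansions -/

theorem mainTheorem2 {k A B : Type*} [Field k] [CommRing A] [CommRing B]
    [Algebra k A] [Algebra k B] [IsNoetherianRing A] [IsNoetherianRing B]
    [IsNoetherianRing (A ⊗[k] B)]
    (I : Ideal A) (J : Ideal B) (hI0 : I ≠ ⊥) (hI1 : I ≠ ⊤) (hJ0 : J ≠ ⊥) (hJ1 : J ≠ ⊤)
    (s : ℕ) :
    (I.extendLeft k B + J.extendRight k A).minSymbolicPower s =
        ∑ i ∈ Finset.range (s + 1),
          (I.minSymbolicPower i).extendLeft k B *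
            (J.minSymbolicPower (s - i)).extendRight k A ∧
      (I.extendLeft k B + J.extendRight k A).assSymbolicPower s =
        ∑ i ∈ Finset.range (s + 1),
          (I.assSymbolicPower i).extendLeft k B *
            (J.assSymbolicPower (s - i)).extendRight k A := by

  constructor
  -- Both notions unfold definitionally to `Ideal.symbolicPowerOn` for the sets given here.
  · refine Ideal.symbolicPowerOn_add (X := {p | p.asIdeal ∈ I.minimalPrimes})
      (Y := {q | q.asIdeal ∈ J.minimalPrimes})
      (Z := {P | P.asIdeal ∈ (I.extendLeft k B + J.extendRight k A).minimalPrimes})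
      ?_ I J (fun P hP => ?_) (fun P hP => ?_) (fun t ht p hp q hq => ?_) s
    · exact (Ideal.finite_minimalPrimes_of_isNoetherianRing _ _).preimage
        fun P _ P' _ h => PrimeSpectrum.ext h
    · obtain ⟨p, hp, hPp⟩ := Ideal.exists_associatedPrimes_comap_includeLeft_le
        (Ideal.mem_associatedPrimes_extend_radical hP)
      exact ⟨p, Ideal.mem_minimalPrimes_of_mem_associatedPrimes_radical hp, hPp⟩
    · obtain ⟨q, hq, hPq⟩ := Ideal.exists_associatedPrimes_comap_includeRight_le
        (Ideal.mem_associatedPrimes_extend_radical hP)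
      exact ⟨q, Ideal.mem_minimalPrimes_of_mem_associatedPrimes_radical hq, hPq⟩
    · exact Ideal.residueTensor_mem_nonZeroDivisors_of_forall_notMem_minimalPrimes
        (fun P hP => ht ⟨P, hP.1.1⟩ hP) hp hq
  · refine Ideal.symbolicPowerOn_add (X := {p | p.asIdeal ∈ associatedPrimes A (A ⧸ I)})
      (Y := {q | q.asIdeal ∈ associatedPrimes B (B ⧸ J)})
      (Z := {P | P.asIdeal ∈ associatedPrimes (A ⊗[k] B)
        (A ⊗[k] B ⧸ I.extendLeft k B + J.extendRight k A)})
      ?_ I J (fun P hP => Ideal.exists_associatedPrimes_comap_includeLeft_le hP)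
      (fun P hP => Ideal.exists_associatedPrimes_comap_includeRight_le hP)
      (fun t ht p hp q hq => ?_) s
    · exact (associatedPrimes.finite _ _).preimage fun P _ P' _ h => PrimeSpectrum.ext h
    · exact Ideal.residueTensor_mem_nonZeroDivisors_of_forall_notMem_associatedPrimes
        (fun P hP => ht ⟨P, hP.isPrime⟩ hP) hp hq
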